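/- Let $A$ be a C*-algebra (not necessarily unital), let $n$ be a positive integer, let $M_n$ be the C*-algebra of complex $n \times n$ matrices with its standard matrix units $(e_{j,k})_{j,k=1}^n$, and let $\varphi \colon M_n \to A$ be a linear map. Let $C M_n = C_0((0,1]) \otimes M_n = \{ f \in C([0,1], M_n) : f(0) = 0 \}$ be the cone over $M_n$, let $t \in C_0((0,1])$ be the function $t(\lambda) = \lambda$, and let $A^+$ be the unitization of $A$ (a new identity is added even if $A$ is already unital), with identity $1$. A linear map $\psi$ between C*-algebras has order zero if $\psi(a)\psi(b) = 0$ whenever $a, b \geq 0$ and $ab = 0$. Put $x_{j,k} = \varphi(e_{j,k})$ for $j, k = 1, \ldots, n$, and consider the following relations: (a) $x_{j,k} x_{k,m} = x_{j,l} x_{l,m}$ for $j, k, l, m = 1, \ldots, n$; (b) $x_{j,j} x_{k,k} = 0$ for $j, k = 1, \ldots, n$ with $j \neq k$; (c) $x_{j,k} = x_{k,j}^*$ for $j, k = 1, \ldots, n$; (d) $\| x_{j,j} \| \leq 1$ for $j = 1, \ldots, n$; (e) $\| 1 - x_{j,j} \| \leq 1$ for $j = 1, \ldots, n$; (f) $x_{j,j}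 \geq 0$ for $j = 1, \ldots, n$. Then the following are equivalent: (1) $\varphi$ is completely positive and contractive and has order zero. (2) There is a $*$-homomorphism $\pi \colon C M_n \to A$ such that $\varphi(z) = \pi(t \otimes z)$ for all $z \in M_n$. (3) The elements $x_{j,k}$ satisfy (a), (b), (c), (d) and (e) as elements of the C*-algebra $A^+$. (4) The elements $x_{j,k}$ satisfy (a), (b), (c), (d) and (f) as elements of the C*-algebra $A$. -/

import Mathlib

open scoped ComplexOrder CStarAlgebra

/-- The C*-algebra `M_n` of complex `n × n` matrices, with the operator norm
and the usual order. -/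
abbrev MatAlg (n : ℕ) : Type := CStarMatrix (Fin n) (Fin n) ℂ

/-- The standard matrix unit `e_{j,k}` of `M_n`. -/
def matUnit {n : ℕ} (j k : Fin n) : MatAlg n :=
  CStarMatrix.ofMatrix (Matrix.single j k (1 : ℂ))

/-- The cone `C B = {f ∈ C([0, 1], B) : f(0) = 0}` over a C*-algebra `B`, with pointwise operations
and the supremum norm. -/
def cone (B : Type*) [NonUnitalCStarAlgebra B] : NonUnitalStarSubalgebra ℂ C(unitInterval, B) where
  carrier := {f | f 0 = 0}
  add_mem' {f g} hf hg := by
    simp only [Set.mem_ofPred_eq] at hf hg ⊢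
    simp [hf, hg]
  zero_mem' := by simp
  mul_mem' {f g} hf hg := by
    simp only [Set.mem_ofPred_eq] at hf hg ⊢
    simp [hf]
  smul_mem' c f hf := by
    simp only [Set.mem_ofPred_eq] at hf ⊢
    simp [hf]
  star_mem' {f} hf := by
    simp only [Set.mem_ofPred_eq] at hf ⊢
    simp [hf]

/-- The element `t ⊗ b` of the cone `C B`, that is, the function `s ↦ s b` on `[0, 1]`. -/
def coneTensor {B : Type*} [NonUnitalCStarAlgebra B] (b : B) : cone B :=
  ⟨⟨fun s => ((s : ℝ) : ℂ) • b, by fun_prop⟩, by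
    change (((0 : unitInterval) : ℝ) : ℂ) • b = 0
    simp⟩

/-- Complete positivity of a linear map: it underlies a completely positive map. -/
def IsCP {A₁ A₂ : Type*} [NonUnitalCStarAlgebra A₁] [NonUnitalCStarAlgebra A₂]
    [PartialOrder A₁] [PartialOrder A₂] [StarOrderedRing A₁] [StarOrderedRing A₂]
    (φ : A₁ →ₗ[ℂ] A₂) : Prop :=
  ∃ ψ : A₁ →CP A₂, ψ.toLinearMap = φ

/-- A linear map has order zero if it sends orthogonal positive elements to orthogonal
elements. (For positive `a`, `b` the conditions `a b = 0` and `b a = 0` are equivalent, by taking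
adjoints; for a completely positive map the images of `a` and `b` are again positive.) -/
def IsOrderZero {A₁ A₂ : Type*} [NonUnitalCStarAlgebra A₁] [NonUnitalCStarAlgebra A₂]
    [PartialOrder A₁] (φ : A₁ →ₗ[ℂ] A₂) : Prop :=
  ∀ a b : A₁, 0 ≤ a → 0 ≤ b → a * b = 0 → φ a * φ b = 0

/-- The relations on a family `x_{j,k}` in a C*-algebra that do not involve
a unit or the order. -/
structure ConeRelations {n : ℕ} {B : Type*} [NonUnitalCStarAlgebra B]
    (x : Fin n → Fin n → B) : Prop where
  mul_eq : ∀ j k l m, x j k * x k m = x j l * x l m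
  orthogonal : ∀ j k, j ≠ k → x j j * x k k = 0
  adjoint : ∀ j k, x j k = star (x k j)
  norm_le : ∀ j, ‖x j j‖ ≤ 1

/-! The key is (4) ⇒ (2). The relations make `h = ∑ x_{j,j}` a positive contraction commuting with
every `x_{j,k}`, with `x_{j,k} x_{k,m} = h x_{j,m}`. So `π (t F)` has to be `∑ F_{j,k}(h) x_{j,k}`.
This is bounded in terms of `‖t F‖`, and the functions `t F` are dense in the cone, so it extends
(`exists_coneHom`, `linearMap_mul`, `norm_mul_le`). For (1) ⇒ (4), complete positivity upgrades
order zero to: `a b = 0` implies `φ a * φ b = 0` for arbitrary `a`, `b`. For (2) ⇒ (1), `t = √t √t`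
exhibits `φ` as completely positive. (3) ⇔ (4) is a norm criterion for positivity in the
unitization. -/

lemma exists_eq_star_mul_self_of_nonneg {B : Type*} [NonUnitalCStarAlgebra B] [PartialOrder B]
    [StarOrderedRing B] {b : B} (hb : 0 ≤ b) : ∃ c, b = star c * c :=
  CStarAlgebra.nonneg_iff_eq_star_mul_self.mp hb

/-! ### Order zero maps and orthogonality -/

lemma CompletelyPositiveMap.map_star_apply {A₁ A₂ : Type*}
    [NonUnitalCStarAlgebra A₁] [NonUnitalCStarAlgebra A₂] [PartialOrder A₁] [PartialOrder A₂]
    [StarOrderedRing A₁] [StarOrderedRing A₂] (ψ : A₁ →CP A₂) (a : A₁) :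
    ψ (star a) = star (ψ a) :=
  map_star ψ a

lemma CompletelyPositiveMap.map_mul_eq_zero_of_map_star_mul_self {A₁ A₂ : Type*}
    [CStarAlgebra A₁] [NonUnitalCStarAlgebra A₂] [PartialOrder A₁] [PartialOrder A₂]
    [StarOrderedRing A₁] [StarOrderedRing A₂] (ψ : A₁ →CP A₂) (a : A₁) (s : A₂)
    (h : ψ (star a * a) * s = 0) : ψ a * s = 0 := by
  -- `star N * N` is `[[1, a], [star a, star a * a]]`. Writing its image as `star Y * Y`, the
  -- hypothesis kills `Y l 1 * s`, which is a factor of every term of `ψ a * s`.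
  let N : CStarMatrix (Fin 2) (Fin 2) A₁ := CStarMatrix.ofMatrix !![1, a; 0, 0]
  obtain ⟨Y, hY⟩ := exists_eq_star_mul_self_of_nonneg
    (ψ.map_cstarMatrix_nonneg (star N * N) (star_mul_self_nonneg N))
  have entry (i j : Fin 2) : ψ ((star N * N) i j) = ∑ l, star (Y l i) * Y l j := by
    have := congrFun (congrFun hY i) j
    simpa [CStarMatrix.mul_apply, CStarMatrix.star_apply] using this
  have h01 : ψ a = ∑ l, star (Y l 0) * Y l 1 := by
    rw [← entry]
    simp [N, CStarMatrix.mul_apply, CStarMatrix.star_apply]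
  have h11 : ψ (star a * a) = ∑ l, star (Y l 1) * Y l 1 := by
    rw [← entry]
    simp [N, CStarMatrix.mul_apply, CStarMatrix.star_apply]
  have hsum : ∑ l, star (Y l 1 * s) * (Y l 1 * s) = 0 := by
    have : star s * (ψ (star a * a) * s) = 0 := by rw [h, mul_zero]
    rw [h11, Finset.sum_mul, Finset.mul_sum] at this
    simpa [mul_assoc] using this
  have hz (l : Fin 2) : Y l 1 * s = 0 := by
    have := (Finset.sum_eq_zero_iff_of_nonneg
      (fun l _ => star_mul_self_nonneg (Y l 1 * s))).mp hsum l (Finset.mem_univ l)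
    exact CStarRing.star_mul_self_eq_zero_iff _ |>.mp this
  rw [h01, Finset.sum_mul]
  simp [mul_assoc, hz]

lemma CompletelyPositiveMap.map_mul_map_eq_zero {A₁ A₂ : Type*}
    [CStarAlgebra A₁] [NonUnitalCStarAlgebra A₂] [PartialOrder A₁] [PartialOrder A₂]
    [StarOrderedRing A₁] [StarOrderedRing A₂] (ψ : A₁ →CP A₂)
    (hψ : IsOrderZero ψ.toLinearMap) {a b : A₁} (hab : a * b = 0) : ψ a * ψ b = 0 := by
  have pos {a b : A₁} (hb : 0 ≤ b) (hab : a * b = 0) : ψ a * ψ b = 0 := by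
    refine ψ.map_mul_eq_zero_of_map_star_mul_self a _ ?_
    exact hψ _ _ (star_mul_self_nonneg a) hb (by rw [mul_assoc, hab, mul_zero])
  have key : ψ (star b) * ψ (star a) = 0 := by
    refine ψ.map_mul_eq_zero_of_map_star_mul_self (star b) _ ?_
    have := pos (mul_star_self_nonneg b) (show a * (b * star b) = 0 by
      rw [← mul_assoc, hab, zero_mul])
    have := congrArg star this
    rw [star_mul, ← map_star, ← map_star] at this
    simpa using this
  simpa [map_star] using congrArg star key

/-! ### Matrix units and their images -/

section matUnit
variable {n : ℕ}

lemma matUnit_apply (j k l m : Fin n) :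
    (matUnit j k : MatAlg n) l m = if j = l ∧ k = m then 1 else 0 := by
  simp [matUnit, Matrix.single_apply]

lemma matUnit_mul_same (j k m : Fin n) :
    matUnit j k * matUnit k m = (matUnit j m : MatAlg n) :=
  congrArg CStarMatrix.ofMatrix ((Matrix.single_mul_single_same (1 : ℂ) j k m 1).trans
    (by rw [one_mul]))

lemma matUnit_mul_of_ne (j : Fin n) {k l : Fin n} (m : Fin n) (h : k ≠ l) :
    matUnit j k * matUnit l m = (0 : MatAlg n) :=
  congrArg CStarMatrix.ofMatrix (Matrix.single_mul_single_of_ne (1 : ℂ) j k l h 1)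

lemma star_matUnit (j k : Fin n) : star (matUnit j k) = (matUnit k j : MatAlg n) := by
  ext l m
  simp [CStarMatrix.star_apply, matUnit_apply, and_comm, apply_ite]

lemma matUnit_nonneg (j : Fin n) : 0 ≤ (matUnit j j : MatAlg n) := by
  rw [← matUnit_mul_same j j j]
  nth_rw 1 [← star_matUnit]
  exact star_mul_self_nonneg _

lemma norm_matUnit_self_le (j : Fin n) : ‖(matUnit j j : MatAlg n)‖ ≤ 1 := by
  have h := CStarRing.norm_star_mul_self (x := (matUnit j j : MatAlg n))
  rw [star_matUnit, matUnit_mul_same] at h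
  nlinarith [norm_nonneg (matUnit j j : MatAlg n)]

lemma matAlg_eq_sum (z : MatAlg n) : z = ∑ j, ∑ k, z j k • matUnit j k := by
  ext l m
  have apply_sum (f : Fin n → MatAlg n) : (∑ j, f j) l m = ∑ j, f j l m :=
    Matrix.sum_apply l m Finset.univ f
  simp [apply_sum, matUnit_apply, ite_and]
end matUnit

lemma coneRelations_of_orderZero {A : Type*} [NonUnitalCStarAlgebra A] [PartialOrder A]
    [StarOrderedRing A] {n : ℕ} {φ : MatAlg n →ₗ[ℂ] A} (hcp : IsCP φ)
    (hcontr : ∀ z, ‖φ z‖ ≤ ‖z‖) (hφ : IsOrderZero φ) :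
    ConeRelations (fun j k => φ (matUnit j k)) ∧ ∀ j, 0 ≤ φ (matUnit j j) := by
  obtain ⟨ψ, rfl⟩ := hcp
  have zero {a b : MatAlg n} (hab : a * b = 0) : ψ a * ψ b = 0 := ψ.map_mul_map_eq_zero hφ hab
  refine ⟨⟨fun j k l m => ?_, fun j k hjk => zero (matUnit_mul_of_ne _ _ hjk), fun j k => ?_,
    fun j => (hcontr _).trans (norm_matUnit_self_le j)⟩, fun j => ?_⟩
  · change ψ _ * ψ _ = ψ _ * ψ _
    rcases eq_or_ne k l with rfl | hkl
    · rfl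
    -- The signs make this product `e_{j,m} - e_{j,m} = 0`; under `ψ` the cross terms vanish and
    -- relation (a) remains.
    have h := zero (a := matUnit j k + matUnit j l) (b := matUnit k m - matUnit l m) (by
      rw [add_mul, mul_sub, mul_sub, matUnit_mul_same, matUnit_mul_same,
        matUnit_mul_of_ne _ _ hkl, matUnit_mul_of_ne _ _ hkl.symm]
      abel)
    rw [map_add, map_sub, add_mul, mul_sub, mul_sub, zero (matUnit_mul_of_ne _ _ hkl),
      zero (matUnit_mul_of_ne _ _ hkl.symm)] at h
    simpa [sub_eq_zero, ← sub_eq_add_neg] using h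
  · change ψ _ = star (ψ _)
    rw [← ψ.map_star_apply, star_matUnit]
  · exact map_nonneg ψ (matUnit_nonneg j)

/-! ### Passage to the unitization -/

section inr
variable {A : Type*} [NonUnitalCStarAlgebra A]

lemma coneRelations_inr_iff {n : ℕ} {x : Fin n → Fin n → A} :
    ConeRelations (fun j k => (x j k : Unitization ℂ A)) ↔ ConeRelations x := by
  have hinj := Unitization.inr_injective (R := ℂ) (A := A)
  constructor
  · rintro ⟨h₁, h₂, h₃, h₄⟩
    refine ⟨fun j k l m => hinj ?_, fun j k h => hinj ?_, fun j k => hinj ?_, fun j => ?_⟩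
    · simpa using h₁ j k l m
    · simpa using h₂ j k h
    · simpa using h₃ j k
    · simpa [Unitization.norm_inr] using h₄ j
  · rintro ⟨h₁, h₂, h₃, h₄⟩
    refine ⟨fun j k l m => ?_, fun j k h => ?_, fun j k => ?_, fun j => ?_⟩
    · simp only [← Unitization.inr_mul, h₁ j k l m]
    · simp only [← Unitization.inr_mul, h₂ j k h, Unitization.inr_zero]
    · simp only [← Unitization.inr_star, ← h₃ j k]
    · simpa [Unitization.norm_inr] using h₄ j

lemma norm_one_sub_le_one_iff {B : Type*} [CStarAlgebra B] [PartialOrder B] [StarOrderedRing B]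
    {b : B} (hb : IsSelfAdjoint b) (hb₁ : ‖b‖ ≤ 1) : ‖1 - b‖ ≤ 1 ↔ 0 ≤ b := by
  rw [nonneg_iff_isSelfAdjoint_and_quasispectrumRestricts]
  have := SpectrumRestricts.nnreal_iff_nnnorm (t := 1) hb hb₁
  rw [NNReal.coe_one, map_one] at this
  exact ⟨fun h => ⟨hb, this.mpr h⟩, fun h => this.mp h.2⟩
end inr

/-! ### The cone, and why its homomorphisms give order zero maps -/

section cone
variable {B : Type*} [NonUnitalCStarAlgebra B]

-- Closedness makes the cone a C*-algebra, so that *-homomorphisms out of it are contractive.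
instance isClosed_cone : IsClosed (cone B : Set C(unitInterval, B)) :=
  isClosed_singleton.preimage (continuous_eval_const (0 : unitInterval))

lemma cone_ext {f g : cone B} (h : ∀ s, f.1 s = g.1 s) : f = g :=
  Subtype.ext (ContinuousMap.ext h)

lemma norm_coneTensor_le (b : B) : ‖coneTensor b‖ ≤ ‖b‖ := by
  refine (ContinuousMap.norm_le _ (norm_nonneg b)).mpr fun s => ?_
  change ‖((s : ℝ) : ℂ) • b‖ ≤ ‖b‖
  rw [norm_smul, Complex.norm_real, Real.norm_of_nonneg s.2.1]
  exact mul_le_of_le_one_left (norm_nonneg b) s.2.2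

/-- The element `√t ⊗ b` of the cone, whose products give the elements `t ⊗ b`. -/
noncomputable def coneSqrtTensor (b : B) : cone B :=
  ⟨⟨fun s => ((√(s : ℝ) : ℝ) : ℂ) • b, by fun_prop⟩, by
    change ((√((0 : unitInterval) : ℝ) : ℝ) : ℂ) • b = 0
    simp⟩

lemma star_coneSqrtTensor_mul (a b : B) :
    star (coneSqrtTensor a) * coneSqrtTensor b = coneTensor (star a * b) := by
  refine cone_ext fun s => ?_
  change star (((√(s : ℝ) : ℝ) : ℂ) • a) * (((√(s : ℝ) : ℝ) : ℂ) • b) = ((s : ℝ) : ℂ) • _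
  rw [star_smul, smul_mul_smul_comm, Complex.star_def, Complex.conj_ofReal, ← Complex.ofReal_mul,
    Real.mul_self_sqrt s.2.1]

lemma coneTensor_mul_eq_zero {a b : B} (h : a * b = 0) : coneTensor a * coneTensor b = 0 := by
  refine cone_ext fun s => ?_
  change (((s : ℝ) : ℂ) • a) * (((s : ℝ) : ℂ) • b) = 0
  rw [smul_mul_smul_comm, h, smul_zero]

end cone

/-- Since `t ⊗ a* b = (√t ⊗ a)* (√t ⊗ b)`, applying `φ` entrywise to `star N * N` again gives a
matrix of the form `star N' * N'`. -/
lemma isCP_of_coneHom {A B : Type*} [NonUnitalCStarAlgebra A] [PartialOrder A]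
    [StarOrderedRing A] [NonUnitalCStarAlgebra B] [PartialOrder B] [StarOrderedRing B]
    {φ : B →ₗ[ℂ] A} (π : cone B →⋆ₙₐ[ℂ] A) (hπ : ∀ z, φ z = π (coneTensor z)) : IsCP φ := by
  refine ⟨⟨φ, fun k M hM => ?_⟩, rfl⟩
  obtain ⟨N, rfl⟩ := exists_eq_star_mul_self_of_nonneg hM
  have h : (star N * N).map φ =
      star (N.map fun z => π (coneSqrtTensor z)) * N.map fun z => π (coneSqrtTensor z) := by
    ext i j
    simp only [CStarMatrix.map_apply, CStarMatrix.mul_apply, CStarMatrix.star_apply]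
    rw [map_sum]
    refine Finset.sum_congr rfl fun l _ => ?_
    rw [hπ, ← star_coneSqrtTensor_mul, map_mul, map_star]
  exact h ▸ star_mul_self_nonneg _

lemma orderZero_of_coneHom {A B : Type*} [NonUnitalCStarAlgebra A] [PartialOrder A]
    [StarOrderedRing A] [NonUnitalCStarAlgebra B] [PartialOrder B] [StarOrderedRing B]
    {φ : B →ₗ[ℂ] A} (π : cone B →⋆ₙₐ[ℂ] A) (hπ : ∀ z, φ z = π (coneTensor z)) :
    IsCP φ ∧ (∀ z, ‖φ z‖ ≤ ‖z‖) ∧ IsOrderZero φ := by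
  refine ⟨isCP_of_coneHom π hπ, fun z => ?_, fun a b _ _ hab => ?_⟩
  · rw [hπ]
    exact (NonUnitalStarAlgHom.norm_apply_le π _).trans (norm_coneTensor_le z)
  · rw [hπ, hπ, ← map_mul, coneTensor_mul_eq_zero hab, map_zero]

/-! ### Extension from the dense subspace of multiples of `t` -/

section density
variable {B : Type*} [NonUnitalCStarAlgebra B]

/-- Multiplication of `B`-valued functions on the unit interval by the coordinate function, as a
map into the cone. -/
def mulCoord : C(unitInterval, B) →ₗ[ℂ] cone B where
  toFun f := ⟨⟨fun s => ((s : ℝ) : ℂ) • f s, by fun_prop⟩, by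
    change (((0 : unitInterval) : ℝ) : ℂ) • f 0 = 0
    simp⟩
  map_add' f g := cone_ext fun s => smul_add _ _ _
  map_smul' c f := cone_ext fun s => smul_comm _ _ _

lemma mulCoord_apply (f : C(unitInterval, B)) (s : unitInterval) :
    (mulCoord f).1 s = ((s : ℝ) : ℂ) • f s := rfl

lemma mulCoord_mul (f g : C(unitInterval, B)) :
    mulCoord f * mulCoord g = mulCoord ((mulCoord f).1 * g) :=
  cone_ext fun s => by
    change (((s : ℝ) : ℂ) • f s) * (((s : ℝ) : ℂ) • g s) =
      ((s : ℝ) : ℂ) • ((((s : ℝ) : ℂ) • f s) * g s)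
    rw [mul_smul_comm]

lemma star_mulCoord (f : C(unitInterval, B)) : star (mulCoord f) = mulCoord (star f) :=
  cone_ext fun s => by
    change star (((s : ℝ) : ℂ) • f s) = ((s : ℝ) : ℂ) • star (f s)
    simp [star_smul]

lemma denseRange_mulCoord : DenseRange (mulCoord (B := B)) := by
  intro f
  refine Metric.mem_closure_iff.mpr fun ε hε => ?_
  obtain ⟨δ, hδ, hf⟩ := Metric.continuousAt_iff.mp (f.1.continuous.continuousAt (x := 0)) (ε / 2)
    (half_pos hε)
  have hf0 : f.1 0 = 0 := f.2
  have hmax (s : unitInterval) : 0 < max (s : ℝ) (δ / 2) := lt_max_of_lt_right (half_pos hδ)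
  -- A regularized `f / t`: `t g` equals `f` where `s ≥ δ / 2`, and below that it is `f` scaled by a
  -- factor in `[0, 1]`, where `f` is already small.
  let g : C(unitInterval, B) := ⟨fun s => (((max (s : ℝ) (δ / 2))⁻¹ : ℝ) : ℂ) • f.1 s, by
    have : Continuous fun s : unitInterval => (max (s : ℝ) (δ / 2))⁻¹ :=
      Continuous.inv₀ (by fun_prop) fun s => (hmax s).ne'
    fun_prop⟩
  refine ⟨_, ⟨g, rfl⟩, ?_⟩
  refine lt_of_le_of_lt ((ContinuousMap.dist_le (half_pos hε).le).mpr fun s => ?_)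
    (half_lt_self hε)
  have hg : (mulCoord g).1 s = (((s : ℝ) * (max (s : ℝ) (δ / 2))⁻¹ : ℝ) : ℂ) • f.1 s := by
    rw [Complex.ofReal_mul, mul_smul]
    rfl
  rw [hg, dist_eq_norm]
  rcases le_or_gt (δ / 2) s with hs | hs
  · rw [max_eq_left hs, mul_inv_cancel₀ ((half_pos hδ).trans_le hs).ne']
    simpa using (half_pos hε).le
  · have hsmall : ‖f.1 s‖ < ε / 2 := by
      have := hf (x := s) (by
        rw [Subtype.dist_eq, Real.dist_eq]
        simp only [Set.Icc.coe_zero, sub_zero, abs_of_nonneg s.2.1]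
        linarith)
      rwa [hf0, dist_zero_right] at this
    set r : ℝ := (s : ℝ) * (max (s : ℝ) (δ / 2))⁻¹ with hr
    have hr0 : 0 ≤ r := mul_nonneg s.2.1 (inv_nonneg.mpr (hmax s).le)
    have hr1 : r ≤ 1 := by
      rw [hr, ← div_eq_mul_inv, div_le_one (hmax s)]
      exact le_max_left _ _
    have : f.1 s - ((r : ℝ) : ℂ) • f.1 s = ((1 - r : ℝ) : ℂ) • f.1 s := by
      rw [Complex.ofReal_sub, sub_smul, Complex.ofReal_one, one_smul]
    rw [this, norm_smul, Complex.norm_real, Real.norm_of_nonneg (by linarith)]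
    exact (mul_le_of_le_one_left (norm_nonneg _) (by linarith)).trans hsmall.le

/-- A bounded linear map that is compatible with the products and adjoints of functions multiplied
by the coordinate function extends to a *-homomorphism of the cone. -/
lemma exists_coneHom {A : Type*} [NonUnitalCStarAlgebra A] (L : C(unitInterval, B) →ₗ[ℂ] A)
    (hbound : ∃ C, ∀ f, ‖L f‖ ≤ C * ‖mulCoord f‖)
    (hmul : ∀ f g, L ((mulCoord f).1 * g) = L f * L g)
    (hstar : ∀ f, L (star f) = star (L f)) :
    ∃ π : cone B →⋆ₙₐ[ℂ] A, ∀ f, π (mulCoord f) = L f := by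
  let E : cone B →L[ℂ] A := L.extendOfNorm mulCoord
  have hE (f) : E (mulCoord f) = L f := LinearMap.extendOfNorm_eq denseRange_mulCoord hbound f
  refine ⟨{ E with
    map_zero' := map_zero E
    map_mul' := fun a b => ?_
    map_star' := fun a => ?_ }, hE⟩
  · change E (a * b) = E a * E b
    refine denseRange_mulCoord.induction_on₂ (p := fun a b => E (a * b) = E a * E b)
      (isClosed_eq (by fun_prop) (by fun_prop)) (fun f g => ?_) a b
    rw [mulCoord_mul, hE, hE, hE, hmul]
  · change E (star a) = star (E a)
    refine denseRange_mulCoord.induction_on (p := fun a => E (star a) = star (E a)) a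
      (isClosed_eq (by fun_prop) (by fun_prop)) (fun f => ?_)
    rw [star_mulCoord, hE, hE, hstar]

end density

/-! ### The homomorphism built from the relations -/

namespace ConeRelations

section algebra
variable {n : ℕ} {B : Type*} [NonUnitalCStarAlgebra B] {x : Fin n → Fin n → B}

lemma star_eq (hx : ConeRelations x) (j k : Fin n) : star (x j k) = x k j :=
  (hx.adjoint k j).symm

/-- The C*-identity, applied once on each side, reduces to diagonal elements: (a) turns `x_{l,m}
x_{m,l}` into `x_{l,l}²`, and then (b) applies. -/
lemma mul_eq_zero (hx : ConeRelations x) {k l : Fin n} (hkl : k ≠ l) (j m : Fin n) :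
    x j k * x l m = 0 := by
  have hd : x k k * x l m = 0 := by
    refine (CStarRing.mul_star_self_eq_zero_iff _).mp ?_
    rw [star_mul, hx.star_eq, hx.star_eq, mul_assoc, ← mul_assoc (x l m), hx.mul_eq l m l l,
      mul_assoc (x l l), ← mul_assoc, hx.orthogonal k l hkl, zero_mul]
  refine (CStarRing.star_mul_self_eq_zero_iff _).mp ?_
  rw [star_mul, hx.star_eq, hx.star_eq, mul_assoc, ← mul_assoc (x k j), hx.mul_eq k j k k,
    mul_assoc (x k k), hd, mul_zero, mul_zero]

lemma sum_mul (hx : ConeRelations x) (j k : Fin n) : (∑ l, x l l) * x j k = x j j * x j k := by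
  rw [Finset.sum_mul]
  exact Finset.sum_eq_single j (fun l _ h => hx.mul_eq_zero h l k) (by simp)

lemma commute_sum (hx : ConeRelations x) (j k : Fin n) : Commute (∑ l, x l l) (x j k) := by
  have : x j k * ∑ l, x l l = x j k * x k k := by
    rw [Finset.mul_sum]
    exact Finset.sum_eq_single k (fun l _ h => hx.mul_eq_zero h.symm j l) (by simp)
  rw [Commute, SemiconjBy, hx.sum_mul, this, hx.mul_eq j k j k]

lemma mul_eq_sum_mul (hx : ConeRelations x) (j k m : Fin n) :
    x j k * x k m = (∑ l, x l l) * x j m := by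
  rw [hx.sum_mul, hx.mul_eq j k j m]

lemma isSelfAdjoint_sum (hx : ConeRelations x) : IsSelfAdjoint (∑ l, x l l) :=
  _root_.isSelfAdjoint_sum _ fun l _ => hx.star_eq l l

lemma norm_sum_le (hx : ConeRelations x) : ‖∑ l, x l l‖ ≤ 1 := by
  rw [← coe_nnnorm, IsSelfAdjoint.nnnorm_sum_eq_sup (f := fun l => x l l) Finset.univ
    (fun l _ => hx.star_eq l l) (fun j k h => hx.orthogonal j k h)]
  exact NNReal.coe_le_one.mpr (Finset.sup_le fun l _ => hx.norm_le l)

end algebra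

section functionalCalculus
variable {n : ℕ} {B : Type*} [CStarAlgebra B] {x : Fin n → Fin n → B}

/-- The functional calculus on the unit interval of a selfadjoint element, the spectrum being
retracted onto the unit interval. -/
noncomputable def intervalHom {h : B} (hh : IsSelfAdjoint h) : C(unitInterval, ℂ) →⋆ₐ[ℂ] B :=
  (cfcHom (R := ℂ) hh.isStarNormal).comp (ContinuousMap.compStarAlgHom' ℂ ℂ
    ⟨fun z : spectrum ℂ h => Set.projIcc (0 : ℝ) 1 zero_le_one z.1.re, by
      exact continuous_projIcc.comp (by fun_prop)⟩)

lemma intervalHom_coord [PartialOrder B] [StarOrderedRing B] {h : B} (hh : 0 ≤ h)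
    (h1 : ‖h‖ ≤ 1) :
    intervalHom (IsSelfAdjoint.of_nonneg hh) ⟨fun s => ((s : ℝ) : ℂ), by fun_prop⟩ = h := by
  refine Eq.trans (congrArg (cfcHom _) ?_) (cfcHom_id (IsSelfAdjoint.of_nonneg hh).isStarNormal)
  ext z
  rcases subsingleton_or_nontrivial B with _ | _
  · simpa [spectrum.of_subsingleton] using z.2
  have hz0 : (0 : ℂ) ≤ z := spectrum_nonneg_of_nonneg hh z.2
  have hz1 : (z : ℂ).re ≤ 1 := (Complex.re_le_norm _).trans
    ((spectrum.norm_le_norm_of_mem z.2).trans h1)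
  have hz := Complex.nonneg_iff.mp hz0
  change ((Set.projIcc (0 : ℝ) 1 zero_le_one (z : ℂ).re : ℝ) : ℂ) = z
  rw [Set.projIcc_of_mem zero_le_one ⟨hz.1, hz1⟩]
  exact Complex.ext rfl hz.2

lemma commute_intervalHom {h b : B} (hh : IsSelfAdjoint h) (hb : Commute h b)
    (f : C(unitInterval, ℂ)) : Commute (intervalHom hh f) b :=
  hh.commute_cfcHom _ hb _

variable [PartialOrder B] [StarOrderedRing B]

lemma sum_nonneg (h0 : ∀ j, 0 ≤ x j j) : 0 ≤ ∑ l, x l l := Finset.sum_nonneg fun l _ => h0 l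

/-- `x_{j,k} x_{j,k}* = x_{j,j}² ≤ ∑ x_{l,l}² = h²`; conjugate by `g` and take norms. -/
lemma norm_mul_le (hx : ConeRelations x) (g : B) (j k : Fin n) : ‖g * x j k‖ ≤ ‖g * ∑ l, x l l‖ := by
  refine abs_le_of_sq_le_sq' ?_ (norm_nonneg _) |>.2
  rw [sq, sq, ← CStarRing.norm_self_mul_star, ← CStarRing.norm_self_mul_star (x := g * _)]
  refine CStarAlgebra.norm_le_norm_of_nonneg_of_le (mul_star_self_nonneg _) ?_
  have assoc (b : B) : g * b * star (g * b) = g * (b * star b) * star g := by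
    simp only [star_mul, mul_assoc]
  rw [assoc, assoc]
  refine star_right_conjugate_le_conjugate ?_ g
  rw [hx.isSelfAdjoint_sum.star_eq, hx.star_eq, hx.mul_eq j k j j, Finset.mul_sum]
  simp only [hx.sum_mul]
  exact Finset.single_le_sum (f := fun l => x l l * x l l) (fun l _ => by
    simpa [hx.star_eq] using star_mul_self_nonneg (x l l)) (Finset.mem_univ j)

/-- The bound is by `‖t f‖`, not `‖f‖`, because `f(h) h = (t f)(h)`; this is what permits extension
to the cone. -/
lemma norm_intervalHom_mul_le (hx : ConeRelations x) (h0 : ∀ j, 0 ≤ x j j)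
    (f : C(unitInterval, ℂ)) (j k : Fin n) :
    ‖intervalHom (IsSelfAdjoint.of_nonneg (sum_nonneg h0)) f * x j k‖ ≤ ‖mulCoord f‖ := by
  refine (hx.norm_mul_le _ j k).trans ?_
  have h := intervalHom_coord (sum_nonneg h0) hx.norm_sum_le
  conv_lhs => enter [1, 2]; rw [← h]
  rw [← map_mul, mul_comm]
  exact NonUnitalStarAlgHom.norm_apply_le (intervalHom _) _

end functionalCalculus

/-- The entries of a matrix-valued function, as a linear map. -/
noncomputable def _root_.entryMap {n : ℕ} (j k : Fin n) :
    C(unitInterval, MatAlg n) →ₗ[ℂ] C(unitInterval, ℂ) where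
  toFun F := ⟨fun s => F s j k, by
    have : Continuous fun M : MatAlg n => M j k := continuous_apply_apply j k
    exact this.comp F.continuous⟩
  map_add' _ _ := rfl
  map_smul' _ _ := rfl

section hom
variable {n : ℕ} {B : Type*} [CStarAlgebra B] {x : Fin n → Fin n → B} [PartialOrder B]
  [StarOrderedRing B]

lemma _root_.norm_mulCoord_entryMap_le (F : C(unitInterval, MatAlg n)) (j k : Fin n) :
    ‖mulCoord (entryMap j k F)‖ ≤ ‖mulCoord F‖ := by
  refine (ContinuousMap.norm_le _ (norm_nonneg _)).mpr fun s => ?_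
  exact (CStarMatrix.norm_entry_le_norm (M := (mulCoord F).1 s) (i := j) (j := k)).trans
    ((mulCoord F).1.norm_coe_le_norm s)

/-- The map `F ↦ ∑ F_{j,k}(h) x_{j,k}` with `h = ∑ x_{j,j}`. -/
noncomputable def linearMap (x : Fin n → Fin n → B) (h0 : ∀ j, 0 ≤ x j j) :
    C(unitInterval, MatAlg n) →ₗ[ℂ] B :=
  ∑ j, ∑ k, LinearMap.mulRight ℂ (x j k) ∘ₗ
    (intervalHom (IsSelfAdjoint.of_nonneg (sum_nonneg h0))).toAlgHom.toLinearMap ∘ₗ entryMap j k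

lemma linearMap_apply (h0 : ∀ j, 0 ≤ x j j) (F : C(unitInterval, MatAlg n)) :
    linearMap x h0 F = ∑ j, ∑ k,
      intervalHom (IsSelfAdjoint.of_nonneg (sum_nonneg h0)) (entryMap j k F) * x j k := by
  simp [linearMap]

lemma norm_linearMap_le (hx : ConeRelations x) (h0 : ∀ j, 0 ≤ x j j)
    (F : C(unitInterval, MatAlg n)) :
    ‖linearMap x h0 F‖ ≤ (n * n : ℝ) * ‖mulCoord F‖ := by
  have : ∀ j, ‖∑ k, intervalHom (IsSelfAdjoint.of_nonneg (sum_nonneg h0)) (entryMap j k F) *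
      x j k‖ ≤ n * ‖mulCoord F‖ := fun j => by
    simpa using norm_sum_le_of_le Finset.univ fun k _ =>
      (hx.norm_intervalHom_mul_le h0 (entryMap j k F) j k).trans
        (norm_mulCoord_entryMap_le F j k)
  rw [linearMap_apply]
  simpa [mul_assoc] using norm_sum_le_of_le Finset.univ fun j _ => this j

lemma linearMap_star (hx : ConeRelations x) (h0 : ∀ j, 0 ≤ x j j)
    (F : C(unitInterval, MatAlg n)) : linearMap x h0 (star F) = star (linearMap x h0 F) := by
  simp only [linearMap_apply, star_sum, star_mul, hx.star_eq]
  rw [Finset.sum_comm]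
  refine Finset.sum_congr rfl fun k _ => Finset.sum_congr rfl fun j _ => ?_
  rw [← map_star, ← (commute_intervalHom _ (hx.commute_sum j k) _).eq]
  rfl

/-- The extra factor `t` on the left matches the factor `h` in `x_{j,k} x_{k,m} = h x_{j,m}`. -/
lemma linearMap_mul (hx : ConeRelations x) (h0 : ∀ j, 0 ≤ x j j)
    (F G : C(unitInterval, MatAlg n)) :
    linearMap x h0 ((mulCoord F).1 * G) = linearMap x h0 F * linearMap x h0 G := by
  set Φ := intervalHom (IsSelfAdjoint.of_nonneg (sum_nonneg h0)) with hΦ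
  set c : C(unitInterval, ℂ) := ⟨fun s => ((s : ℝ) : ℂ), by fun_prop⟩ with hc
  have hΦc : Φ c = ∑ l, x l l := intervalHom_coord (sum_nonneg h0) hx.norm_sum_le
  have entry (j m : Fin n) : entryMap j m ((mulCoord F).1 * G) =
      ∑ k, c * (entryMap j k F * entryMap k m G) := by
    ext s
    rw [ContinuousMap.sum_apply]
    change (((mulCoord F).1 s * G s : MatAlg n)) j m = ∑ k, (s : ℝ) * (F s j k * G s k m)
    rw [CStarMatrix.mul_apply]
    refine Finset.sum_congr rfl fun k _ => ?_
    rw [← mul_assoc]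
    rfl
  have term (j k l m : Fin n) (f g : C(unitInterval, ℂ)) :
      Φ f * x j k * (Φ g * x l m) = if k = l then Φ (c * (f * g)) * x j m else 0 := by
    have h1 : Φ f * x j k * (Φ g * x l m) = Φ f * Φ g * (x j k * x l m) := by
      rw [mul_assoc, ← mul_assoc (x j k), ← (commute_intervalHom _ (hx.commute_sum j k) g).eq]
      simp only [mul_assoc, hΦ]
    rw [h1]
    split_ifs with h
    · subst h
      rw [hx.mul_eq_sum_mul, ← hΦc, ← mul_assoc, ← map_mul, ← map_mul, mul_comm c]
    · rw [hx.mul_eq_zero h, mul_zero]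
  simp only [linearMap_apply, ← hΦ, entry, map_sum, Finset.sum_mul, Finset.mul_sum, term]
  simp only [map_mul, Finset.sum_ite_eq', Finset.mem_univ, ↓reduceIte]
  rw [Finset.sum_congr rfl fun j _ => Finset.sum_comm, Finset.sum_comm]
  exact Finset.sum_congr rfl fun k _ => Finset.sum_comm

lemma linearMap_const (h0 : ∀ j, 0 ≤ x j j) (z : MatAlg n) :
    linearMap x h0 (ContinuousMap.const _ z) = ∑ j, ∑ k, z j k • x j k := by
  rw [linearMap_apply]
  refine Finset.sum_congr rfl fun j _ => Finset.sum_congr rfl fun k _ => ?_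
  have : entryMap j k (ContinuousMap.const _ z) = algebraMap ℂ _ (z j k) := rfl
  rw [this, AlgHomClass.commutes, Algebra.smul_def]

end hom
end ConeRelations

lemma exists_coneHom_of_coneRelations {A : Type*} [NonUnitalCStarAlgebra A] [PartialOrder A]
    [StarOrderedRing A] {n : ℕ} {φ : MatAlg n →ₗ[ℂ] A}
    (hx : ConeRelations fun j k => φ (matUnit j k)) (h0 : ∀ j, 0 ≤ φ (matUnit j j)) :
    ∃ π : cone (MatAlg n) →⋆ₙₐ[ℂ] A, ∀ z, φ z = π (coneTensor z) := by
  have hinj := Unitization.inr_injective (R := ℂ) (A := A)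
  have hx' := coneRelations_inr_iff.mpr hx
  have h0' : ∀ j, 0 ≤ (φ (matUnit j j) : Unitization ℂ A) := fun j =>
    Unitization.inr_nonneg_iff.mpr (h0 j)
  set L' := ConeRelations.linearMap (fun j k => (φ (matUnit j k) : Unitization ℂ A)) h0' with hL'
  let L : C(unitInterval, MatAlg n) →ₗ[ℂ] A := Unitization.sndHom ℂ ℂ A ∘ₗ L'
  -- Each term is a multiple of some `x_{j,k}` in the ideal `A`, so the values of `L'` lie in `A`.
  have hfst (F) : (L' F).fst = 0 := by
    change Unitization.fstHom ℂ A (L' F) = 0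
    rw [hL', ConeRelations.linearMap_apply]
    simp
  have hL (F) : (L F : Unitization ℂ A) = L' F :=
    Unitization.ext (by simp [hfst]) rfl
  obtain ⟨π, hπ⟩ := exists_coneHom L ⟨n * n, fun F => by
      rw [← Unitization.norm_inr (𝕜 := ℂ), hL]
      exact hx'.norm_linearMap_le h0' F⟩
    (fun F G => hinj (by rw [Unitization.inr_mul, hL, hL, hL]; exact hx'.linearMap_mul h0' F G))
    (fun F => hinj (by rw [Unitization.inr_star, hL, hL]; exact hx'.linearMap_star h0' F))
  refine ⟨π, fun z => hinj ?_⟩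
  change _ = (π (mulCoord (ContinuousMap.const _ z)) : Unitization ℂ A)
  rw [hπ, hL, hL', ConeRelations.linearMap_const h0']
  conv_lhs => rw [matAlg_eq_sum z]
  change Unitization.inrHom ℂ ℂ A (φ _) = _
  simp only [map_sum, map_smul]
  rfl

theorem corollary1p5 {A : Type*} [NonUnitalCStarAlgebra A] [PartialOrder A] [StarOrderedRing A]
    (n : ℕ) (hn : 0 < n) (φ : MatAlg n →ₗ[ℂ] A) :
    List.TFAE [
      IsCP φ ∧ (∀ z : MatAlg n, ‖φ z‖ ≤ ‖z‖) ∧ IsOrderZero φ,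
      ∃ π : cone (MatAlg n) →⋆ₙₐ[ℂ] A, ∀ z : MatAlg n, φ z = π (coneTensor z),
      ConeRelations (fun j k => (φ (matUnit j k) : Unitization ℂ A)) ∧
        ∀ j, ‖1 - (φ (matUnit j j) : Unitization ℂ A)‖ ≤ 1,
      ConeRelations (fun j k => φ (matUnit j k)) ∧ ∀ j, 0 ≤ φ (matUnit j j)] := by
  tfae_have 1 → 4 := fun h => coneRelations_of_orderZero h.1 h.2.1 h.2.2
  tfae_have 4 → 2 := fun h => exists_coneHom_of_coneRelations h.1 h.2
  tfae_have 2 → 1 := fun ⟨π, hπ⟩ => orderZero_of_coneHom π hπ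
  tfae_have 3 ↔ 4 := by
    rw [coneRelations_inr_iff (x := fun j k => φ (matUnit j k))]
    refine and_congr_right fun hx => forall_congr' fun j => ?_
    have hx' := coneRelations_inr_iff.mpr hx
    rw [norm_one_sub_le_one_iff (hx'.star_eq j j) (hx'.norm_le j), Unitization.inr_nonneg_iff]
  tfae_finish
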